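/- Reals are infinite binary sequences $X\in 2^{\omega}$; $X\restriction_n$ is the string of the first $n$ digits of $X$, $|\sigma|$ is the length of a string $\sigma$, and $\mu$ is the uniform (Lebesgue) measure on $2^\omega$. For a set $V$ of binary strings, $[V]$ is the set of reals that have a prefix in $V$. A Martin-Löf test is a uniformly c.e. sequence $(V_i)_{i\in\mathbb{N}}$ of sets of binary strings with $\mu([V_i])<2^{-i}$ for all $i$; it is computably granular if there is a computable increasing function $g:\mathbb{N}\to\mathbb{N}$ such that for each $i$ all strings in $V_i$ have length at most $g(i)$. A martingale (supermartingale) is a function $M$ from binary strings to the nonnegative reals with $M(\sigma 0)+M(\sigma 1)=2M(\sigma)$ (respectively $\leq 2M(\sigma)$) for all $\sigma$; it is c.e. if the values $M(\sigma)$ are left-c.e. reals uniformly in $\sigma$. A prefix-free machine is a partial computable function on binary strings no element of whose domain is a proper prefix of another one. $K(\sigma)$ is the length of a shortest program for $\sigma$ with respect to a fixed universal prefix-free machine, and $C(\sigma)$ is the same with respect to a fixed universal machine (plain complexity); universal means optimal, up to an additive constant, among all prefix-free machines, respectively among all partial computable functions on strings. **Theorem (Granular randomness).** For every choice of the universal machines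 underlying $K$ and $C$, the following are equivalent for a real $X$: (a) $X\in\bigcap_i [V_i]$ for some computably granular Martin-Löf test $(V_i)$; (b) there are a c.e. martingale $M$ and a computable function $g:\mathbb{N}\to\mathbb{N}$ such that $M(X\restriction_{g(i)})\geq i$ for all $i$; (b′) there are a c.e. supermartingale $M$ and a computable function $g:\mathbb{N}\to\mathbb{N}$ such that $M(X\restriction_{g(i)})\geq i$ for all $i$; (c) there is a computable function $g:\mathbb{N}\to\mathbb{N}$ such that $K(X\restriction_{g(i)})\leq g(i)-i$ for all $i$; (c′) there is a computable function $g:\mathbb{N}\to\mathbb{N}$ such that $C(X\restriction_{g(i)})\leq g(i)-i$ for all $i$. -/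

import Mathlib

open MeasureTheory

namespace GranularRandomness

/-- Reals are infinite binary sequences. -/
abbrev BinSeq : Type := ℕ → Bool

/-- The initial segment of `X` of length `n`, that is `X 0, …, X (n - 1)`. -/
def initSeg (X : BinSeq) (n : ℕ) : List Bool := (List.range n).map X

/-- The open set of reals that have a prefix in the set of strings `V`. -/
def openSet (V : Set (List Bool)) : Set BinSeq := {X | ∃ n, initSeg X n ∈ V}

/-- Lebesgue measure on binary sequences: the product of the uniform measures on the digits. -/
noncomputable def lebesgue : Measure BinSeq :=
  Measure.infinitePi fun _ : ℕ => (PMF.uniformOfFintype Bool).toMeasure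

/-- A Martin-Löf test: a uniformly c.e. sequence of sets of strings `V i` of measure less than
`2 ^ (-i)`. -/
structure IsMartinLofTest (V : ℕ → Set (List Bool)) : Prop where
  ce : REPred fun p : ℕ × List Bool => p.2 ∈ V p.1
  measure_lt : ∀ i, lebesgue (openSet (V i)) < (2 : ENNReal)⁻¹ ^ i

/-- All strings in `V i` have length at most `g i`. -/
def IsGranular (g : ℕ → ℕ) (V : ℕ → Set (List Bool)) : Prop :=
  ∀ i, ∀ σ ∈ V i, σ.length ≤ g i

/-- `V` is `g`-granular for some computable increasing function `g`. -/
def IsComputablyGranular (V : ℕ → Set (List Bool)) : Prop :=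
  ∃ g : ℕ → ℕ, Computable g ∧ StrictMono g ∧ IsGranular g V

/-- A martingale: a nonnegative function on strings satisfying the averaging condition. -/
structure IsStringMartingale (M : List Bool → ℝ) : Prop where
  nonneg : ∀ σ, 0 ≤ M σ
  fair : ∀ σ, M (σ ++ [false]) + M (σ ++ [true]) = 2 * M σ

/-- A supermartingale: as a martingale, with an inequality in the averaging condition. -/
structure IsStringSupermartingale (M : List Bool → ℝ) : Prop where
  nonneg : ∀ σ, 0 ≤ M σ
  le_fair : ∀ σ, M (σ ++ [false]) + M (σ ++ [true]) ≤ 2 * M σ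

/-- A nonnegative function on strings is c.e. if its values are uniformly left-c.e. reals: the
set of pairs of a string `σ` and a rational number below `M σ` is c.e. As `M` is nonnegative, it
is enough to consider the nonnegative rational numbers, given as fractions `a / (b + 1)`. -/
def IsCE (M : List Bool → ℝ) : Prop :=
  REPred fun p : List Bool × (ℕ × ℕ) => (p.2.1 : ℝ) / ((p.2.2 : ℝ) + 1) < M p.1

/-- The complexity of the string `σ` with respect to the machine `U`: the length of a shortest
program `τ` with `U(τ) = σ`, and `⊤` if there is none. -/
noncomputable def complexity (U : List Bool →. List Bool) (σ : List Bool) : ℕ∞ :=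
  ⨅ τ : List Bool, ⨅ _ : σ ∈ U τ, (τ.length : ℕ∞)

/-- A prefix-free machine: a partial computable function on strings whose domain is an antichain
for the prefix relation. -/
structure IsPrefixFreeMachine (U : List Bool →. List Bool) : Prop where
  partrec : Partrec U
  prefixFree : ∀ σ τ, (U σ).Dom → (U τ).Dom → σ <+: τ → σ = τ

/-- A universal prefix-free machine (optimal up to additive constants among prefix-free machines);
`complexity U` is then prefix-free Kolmogorov complexity `K`. -/
structure IsUniversalPrefixFree (U : List Bool →. List Bool) : Prop where
  machine : IsPrefixFreeMachine U
  optimal : ∀ N : List Bool →. List Bool, IsPrefixFreeMachine N →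
    ∃ c : ℕ, ∀ σ, complexity U σ ≤ complexity N σ + c

/-- A universal machine (optimal up to additive constants among all machines); `complexity W` is
then plain Kolmogorov complexity `C`. -/
structure IsUniversalPlain (W : List Bool →. List Bool) : Prop where
  partrec : Partrec W
  optimal : ∀ N : List Bool →. List Bool, Partrec N →
    ∃ c : ℕ, ∀ σ, complexity W σ ≤ complexity N σ + c

end GranularRandomness

/-!
All five conditions are compared with *level tests*: r.e. families `S i` of strings of one
computable length `h i`, with fewer than `2 ^ (h i - i)` members. A computably granular test is
turned into a level test by extending its strings to the length given by the granularity bound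
(`exists_levelTest`), and a level test is itself a computably granular test
(`IsLevelTest.exists_granular`). At a single level, measure is counting, and this makes both the
martingale and the complexity characterizations elementary.

*Martingales.* The sum over all `τ` in a level test of the martingales
`σ ↦ μ([τ] ∩ [σ]) / μ([σ])` is c.e., since it is the supremum of its finite partial sums along an
enumeration (`IsLevelTest.isCE`). If `h` is increasing, then at length `h i` along a covered `X`
every component below `i` has contributed capital `1` (`IsLevelTest.le_testMartingale`). Conversely,
Markov's inequality at a fixed level (`IsStringSupermartingale.ncard_mul_le`) shows that the strings
on which a c.e. supermartingale is large form a level test.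

*Complexity.* A member of `S (2 * i)` is determined by `i` and by its index in an enumeration, which
needs `h (2 * i) - 2 * i` bits. As this number is computable from `i`, the program `0ⁱ1τ` with `τ`
of that length is self-delimiting, so it yields a prefix-free machine without recourse to the
Kraft–Chaitin theorem (`exists_prefixFree_machine`); half of the saving `2 * i` pays for the unary
`i`. Plain complexity is at most prefix-free complexity up to a constant, and counting programs
shows that strings of computably chosen lengths with small plain complexity form a level test
(`exists_levelTest_of_complexity`).
-/

namespace GranularRandomness

/-! ### Recursively enumerable predicates -/

section REPred

variable {α β γ : Type*} [Primcodable α] [Primcodable β] [Primcodable γ]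

open Nat.Partrec (Code) in
/-- Kleene normal form: an r.e. predicate is the projection of a primitive recursive relation,
here "the computation halts within `t` steps". -/
theorem _root_.REPred.exists_primrec {p : α → Prop} (hp : REPred p) :
    ∃ d : α → ℕ → Bool, Primrec₂ d ∧ ∀ a, p a ↔ ∃ t, d a t = true := by
  obtain ⟨c, hc⟩ := Code.exists_code.1 hp
  refine ⟨fun a t => (Code.evaln t c (Encodable.encode a)).isSome, ?_, fun a => ?_⟩
  · exact Primrec.option_isSome.comp (Code.primrec_evaln.comp
      ((Primrec.snd.pair (Primrec.const c)).pair (Primrec.encode.comp Primrec.fst)))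
  · have h1 : p a ↔ (Code.eval c (Encodable.encode a)).Dom := by
      rw [hc]
      simp [Encodable.encodek, Part.assert, Part.bind]
    rw [h1, Part.dom_iff_mem]
    simp only [Code.evaln_complete, Option.isSome_iff_exists]
    exact exists_comm

theorem _root_.REPred.exists_of_computable {d : α → ℕ → Bool} (hd : Computable₂ d) :
    REPred fun a => ∃ t, d a t = true := by
  have h : Partrec fun a => Nat.rfind fun t => Part.some (d a t) := Partrec.rfind hd.partrec₂
  refine h.dom_re.of_eq fun a => ?_
  refine Nat.rfind_dom'.trans ?_
  simp only [Part.mem_some_iff]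
  constructor
  · rintro ⟨n, h, -⟩
    exact ⟨n, h.symm⟩
  · rintro ⟨n, h⟩
    exact ⟨n, h.symm, fun _ => trivial⟩

theorem _root_.REPred.comp {p : β → Prop} (hp : REPred p) {f : α → β} (hf : Computable f) :
    REPred fun a => p (f a) :=
  Partrec.comp hp hf

theorem _root_.REPred.and {p q : α → Prop} (hp : REPred p) (hq : REPred q) :
    REPred fun a => p a ∧ q a := by
  have h := Partrec.bind hp (Partrec.comp hq (Computable.fst (α := α) (β := Unit))).to₂
  refine h.dom_re.of_eq fun a => ?_
  simp [Part.dom_iff_mem]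

theorem _root_.REPred.exists {p : α × β → Prop} (hp : REPred p) :
    REPred fun a => ∃ b, p (a, b) := by
  obtain ⟨d, hd, h⟩ := hp.exists_primrec
  -- a single natural number codes both the witness and the running time
  have hd' : Primrec₂ fun (a : α) (n : ℕ) =>
      ((Encodable.decode (α := β) n.unpair.1).map fun b => d (a, b) n.unpair.2).getD false := by
    refine Primrec.option_getD.comp (Primrec.option_map ?_ ?_) (Primrec.const false)
    · exact Primrec.decode.comp (Primrec.fst.comp (Primrec.unpair.comp Primrec.snd))
    · exact hd.comp ((Primrec.fst.comp Primrec.fst).pair Primrec.snd)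
        (Primrec.snd.comp (Primrec.unpair.comp (Primrec.snd.comp Primrec.fst)))
  refine (REPred.exists_of_computable hd'.to_comp).of_eq fun a => ?_
  constructor
  · rintro ⟨n, hn⟩
    cases hb : Encodable.decode (α := β) n.unpair.1 with
    | none => simp [hb] at hn
    | some b => exact ⟨b, (h _).2 ⟨_, by simpa [hb] using hn⟩⟩
  · rintro ⟨b, hb⟩
    obtain ⟨t, ht⟩ := (h _).1 hb
    exact ⟨Nat.pair (Encodable.encode b) t, by simpa using ht⟩

theorem _root_.Partrec.mem_re [DecidableEq β] {f : α →. β} (hf : Partrec f) :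
    REPred fun p : α × β => p.2 ∈ f p.1 := by
  have hc : Partrec₂ fun (p : α × β) (y : β) =>
      ((if y = p.2 then some () else none : Option Unit) : Part Unit) := by
    refine Computable.ofOption (Primrec.to_comp ?_)
    exact Primrec.ite (Primrec.eq.comp Primrec.snd (Primrec.snd.comp Primrec.fst))
      (Primrec.const _) (Primrec.const _)
  refine ((hf.comp Computable.fst).bind hc).dom_re.of_eq fun p => ?_
  rw [Part.dom_iff_mem]
  simp only [Part.mem_bind_iff, Part.mem_ofOption]
  constructor
  · rintro ⟨_, y, hy, h⟩
    split_ifs at h with h'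
    · exact h' ▸ hy
    · simp at h
  · intro h
    exact ⟨(), p.2, h, by simp⟩

/-- One step of an enumeration without repetition: stage `s` codes a candidate `x` and a running
time `t`, and `x` is appended if it is confirmed within time `t` and is not yet listed. -/
def enumStep [DecidableEq γ] (d : β × γ → ℕ → Bool) (b : β) (s : ℕ) (l : List γ) : List γ :=
  ((Encodable.decode (α := γ) s.unpair.1).map fun x =>
    if d (b, x) s.unpair.2 = true ∧ ¬ ∃ y ∈ l, y = x then l ++ [x] else l).getD l

/-- The members of the section of an r.e. relation at `b` that are listed before stage `s`. -/
def enumList [DecidableEq γ] (d : β × γ → ℕ → Bool) (b : β) (s : ℕ) : List γ :=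
  Nat.rec [] (fun n l => enumStep d b n l) s

theorem primrec_enumList [DecidableEq γ] {d : β × γ → ℕ → Bool} (hd : Primrec₂ d) :
    Primrec₂ (enumList d) := by
  have hmem : PrimrecRel fun (l : List γ) (x : γ) => ∃ y ∈ l, y = x :=
    PrimrecRel.exists_mem_list Primrec.eq
  have hstep : Primrec fun q : (β × ℕ) × (ℕ × List γ) => enumStep d q.1.1 q.2.1 q.2.2 := by
    unfold enumStep
    refine Primrec.option_getD.comp (Primrec.option_map ?_ ?_) (Primrec.snd.comp Primrec.snd)
    · exact Primrec.decode.comp (Primrec.fst.comp (Primrec.unpair.comp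
        (Primrec.fst.comp Primrec.snd)))
    · have hl : Primrec fun z : ((β × ℕ) × (ℕ × List γ)) × γ => z.1.2.2 :=
        Primrec.snd.comp (Primrec.snd.comp Primrec.fst)
      refine Primrec.ite (PrimrecPred.and ?_ ?_) (Primrec.list_concat.comp hl Primrec.snd) hl
      · refine Primrec.eq.comp (hd.comp ?_ ?_) (Primrec.const true)
        · exact (Primrec.fst.comp (Primrec.fst.comp Primrec.fst)).pair Primrec.snd
        · exact Primrec.snd.comp (Primrec.unpair.comp
            (Primrec.fst.comp (Primrec.snd.comp Primrec.fst)))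
      · exact (hmem.comp hl Primrec.snd).not
  exact Primrec.nat_rec' (f := fun p : β × ℕ => p.2) (g := fun _ => ([] : List γ))
    Primrec.snd (Primrec.const []) hstep.to₂

/-- Every r.e. relation has a uniformly primitive recursive enumeration of its sections by growing
lists without repetitions. -/
theorem _root_.REPred.exists_enumeration [DecidableEq γ] {S : β → Set γ}
    (hS : REPred fun p : β × γ => p.2 ∈ S p.1) :
    ∃ L : β → ℕ → List γ, Primrec₂ L ∧ (∀ b s, (L b s).Nodup) ∧
      (∀ b s t, s ≤ t → L b s <+: L b t) ∧ ∀ b x, x ∈ S b ↔ ∃ s, x ∈ L b s := by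
  obtain ⟨d, hd, h⟩ := hS.exists_primrec
  have hsucc : ∀ b s, enumList d b (s + 1) = enumStep d b s (enumList d b s) := fun _ _ => rfl
  have hpre : ∀ b s t, s ≤ t → enumList d b s <+: enumList d b t := by
    intro b s t hst
    induction t, hst using Nat.le_induction with
    | base => exact List.prefix_rfl
    | succ t _ ih =>
      refine ih.trans ?_
      rw [hsucc]
      unfold enumStep
      cases Encodable.decode (α := γ) t.unpair.1 with
      | none => simp
      | some x =>
        simp only [Option.map_some, Option.getD_some]
        split_ifs
        · exact List.prefix_append _ _
        · exact List.prefix_rfl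
  refine ⟨enumList d, primrec_enumList hd, fun b s => ?_, hpre, fun b x => ⟨fun hx => ?_, ?_⟩⟩
  · induction s with
    | zero => exact List.nodup_nil
    | succ s ih =>
      rw [hsucc]
      unfold enumStep
      cases Encodable.decode (α := γ) s.unpair.1 with
      | none => simpa using ih
      | some x =>
        simp only [Option.map_some, Option.getD_some]
        split_ifs with hc
        · refine List.Nodup.append ih (List.nodup_singleton x) ?_
          intro y hy hy'
          exact hc.2 ⟨y, hy, List.mem_singleton.1 hy'⟩
        · exact ih
  · obtain ⟨t, ht⟩ := (h (b, x)).1 hx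
    refine ⟨Nat.pair (Encodable.encode x) t + 1, ?_⟩
    rw [hsucc]
    simp only [enumStep, Nat.unpair_pair, Encodable.encodek, Option.map_some, Option.getD_some,
      ht, true_and]
    split_ifs with hc
    · obtain ⟨y, hy, rfl⟩ := hc
      exact hy
    · simp
  · rintro ⟨s, hs⟩
    induction s with
    | zero => simp [enumList] at hs
    | succ s ih =>
      rw [hsucc] at hs
      unfold enumStep at hs
      cases hx : Encodable.decode (α := γ) s.unpair.1 with
      | none => exact ih (by simpa [hx] using hs)
      | some y =>
        simp only [hx, Option.map_some, Option.getD_some] at hs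
        split_ifs at hs with hc
        · rcases List.mem_append.1 hs with hs | hs
          · exact ih hs
          · rw [List.mem_singleton.1 hs]
            exact (h (b, y)).2 ⟨_, hc.1⟩
        · exact ih hs

end REPred

theorem primrec_pow : Primrec₂ fun a b : ℕ => a ^ b :=
  Primrec₂.unpaired'.1 Nat.Primrec.pow

theorem _root_.PrimrecRel.computablePred_comp {α β γ : Type*} [Primcodable α] [Primcodable β]
    [Primcodable γ] {R : β → γ → Prop} (hR : PrimrecRel R) {f : α → β} {g : α → γ}
    (hf : Computable f) (hg : Computable g) : ComputablePred fun a => R (f a) (g a) := by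
  obtain ⟨hdec, hR⟩ := hR
  exact ⟨fun a => hdec (f a, g a), hR.to_comp.comp (hf.pair hg)⟩

/-! ### Initial segments and the measure of open sets -/

theorem length_initSeg (X : BinSeq) (n : ℕ) : (initSeg X n).length = n := by
  simp [initSeg]

theorem initSeg_take (X : BinSeq) {m n : ℕ} (h : m ≤ n) :
    (initSeg X n).take m = initSeg X m := by
  simp [initSeg, ← List.map_take, List.take_range, h]

theorem initSeg_prefix (X : BinSeq) {m n : ℕ} (h : m ≤ n) : initSeg X m <+: initSeg X n :=
  initSeg_take X h ▸ List.take_prefix _ _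

theorem initSeg_eq_iff (X : BinSeq) (σ : List Bool) :
    initSeg X σ.length = σ ↔ ∀ k ∈ Finset.range σ.length, X k = σ.getD k false := by
  constructor
  · intro h k hk
    have hk' := Finset.mem_range.1 hk
    rw [← h]
    simp [initSeg, hk']
  · intro h
    refine List.ext_getElem (length_initSeg _ _) fun k hk hk' => ?_
    have := h k (Finset.mem_range.2 hk')
    simp [initSeg, this, hk']

theorem setOf_initSeg_eq (σ : List Bool) :
    {X | initSeg X σ.length = σ} =
      Set.pi (Finset.range σ.length : Set ℕ) fun k => {σ.getD k false} := by
  ext X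
  simp only [Set.mem_ofPred_eq, initSeg_eq_iff, Set.mem_pi, Finset.mem_coe, Set.mem_singleton_iff]

theorem measurableSet_cylinder (σ : List Bool) :
    MeasurableSet {X : BinSeq | initSeg X σ.length = σ} := by
  rw [setOf_initSeg_eq]
  exact MeasurableSet.pi (Finset.countable_toSet _) fun _ _ => MeasurableSet.singleton _

theorem lebesgue_cylinder (σ : List Bool) :
    lebesgue {X | initSeg X σ.length = σ} = (2 : ENNReal)⁻¹ ^ σ.length := by
  rw [setOf_initSeg_eq, lebesgue, Measure.infinitePi_pi _ fun _ _ => MeasurableSet.singleton _]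
  simp

theorem finite_of_length_eq {V : Set (List Bool)} {n : ℕ} (h : ∀ σ ∈ V, σ.length = n) :
    V.Finite :=
  (List.finite_length_eq Bool n).subset h

theorem openSet_of_length_eq {V : Set (List Bool)} {n : ℕ} (h : ∀ σ ∈ V, σ.length = n) :
    openSet V = {X | initSeg X n ∈ V} := by
  ext X
  refine ⟨fun ⟨m, hm⟩ => ?_, fun hX => ⟨n, hX⟩⟩
  have := h _ hm
  rw [length_initSeg] at this
  exact this ▸ hm

theorem lebesgue_openSet {V : Set (List Bool)} {n : ℕ} (h : ∀ σ ∈ V, σ.length = n) :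
    lebesgue (openSet V) = V.ncard * (2 : ENNReal)⁻¹ ^ n := by
  have hf := finite_of_length_eq h
  have hU : openSet V = ⋃ σ ∈ hf.toFinset, {X | initSeg X σ.length = σ} := by
    rw [openSet_of_length_eq h]
    ext X
    simp only [Set.mem_ofPred_eq, Set.mem_iUnion, Set.Finite.mem_toFinset, exists_prop]
    constructor
    · intro hX
      exact ⟨_, hX, by rw [length_initSeg]⟩
    · rintro ⟨σ, hσ, hX⟩
      rw [h σ hσ] at hX
      rwa [hX]
  rw [hU, measure_biUnion_finset]
  · rw [Finset.sum_congr rfl fun σ hσ => by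
      rw [lebesgue_cylinder, h σ (hf.mem_toFinset.1 hσ)]]
    rw [Finset.sum_const, nsmul_eq_mul, Set.ncard_eq_toFinset_card V hf]
  · intro σ hσ τ hτ hne
    refine Set.disjoint_left.2 fun X hX hX' => hne ?_
    simp only [Set.mem_ofPred_eq] at hX hX'
    rw [← hX, ← hX', h σ (by simpa using hσ), h τ (by simpa using hτ)]
  · exact fun σ _ => measurableSet_cylinder σ

/-! ### Level tests -/

/-- A test whose `i`-th component consists of strings of the single length `h i`, so that the
measure condition becomes a condition on cardinalities. -/
structure IsLevelTest (h : ℕ → ℕ) (S : ℕ → Set (List Bool)) : Prop where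
  ce : REPred fun p : ℕ × List Bool => p.2 ∈ S p.1
  length_eq : ∀ i, ∀ σ ∈ S i, σ.length = h i
  card_lt : ∀ i, (S i).ncard * 2 ^ i < 2 ^ h i

theorem card_mul_inv_pow_lt_iff (c i n : ℕ) :
    (c : ENNReal) * (2 : ENNReal)⁻¹ ^ n < (2 : ENNReal)⁻¹ ^ i ↔ c * 2 ^ i < 2 ^ n := by
  rw [← ENNReal.inv_pow, ← ENNReal.inv_pow, ← div_eq_mul_inv,
    ENNReal.div_lt_iff (by simp) (by simp), mul_comm, ← div_eq_mul_inv,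
    ENNReal.lt_div_iff_mul_lt (by simp) (by simp)]
  exact_mod_cast Iff.rfl

/-- Every computable function is dominated by a computable strictly increasing function. -/
theorem exists_strictMono_ge {h : ℕ → ℕ} (hh : Computable h) :
    ∃ g : ℕ → ℕ, Computable g ∧ StrictMono g ∧ ∀ i, h i ≤ g i := by
  let g : ℕ → ℕ := fun n => Nat.rec (h 0) (fun k r => r + h (k + 1) + 1) n
  have hg : Computable g := by
    refine Computable.nat_rec (f := fun n : ℕ => n) (g := fun _ => h 0)
      (h := fun _ (p : ℕ × ℕ) => p.2 + h (p.1 + 1) + 1) Computable.id (Computable.const _) ?_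
    refine Computable.succ.comp ((Primrec.nat_add.to_comp).comp
      (Computable.snd.comp Computable.snd) (hh.comp (Computable.succ.comp
        (Computable.fst.comp Computable.snd))))
  have hs : ∀ n, g (n + 1) = g n + h (n + 1) + 1 := fun _ => rfl
  refine ⟨g, hg, strictMono_nat_of_lt_succ fun n => by rw [hs]; omega, fun i => ?_⟩
  cases i with
  | zero => exact le_rfl
  | succ n => rw [hs]; omega

theorem IsLevelTest.isMartinLofTest {h : ℕ → ℕ} {S : ℕ → Set (List Bool)}
    (hS : IsLevelTest h S) : IsMartinLofTest S where
  ce := hS.ce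
  measure_lt i := by
    rw [lebesgue_openSet (hS.length_eq i), card_mul_inv_pow_lt_iff]
    exact hS.card_lt i

theorem IsLevelTest.isComputablyGranular {h : ℕ → ℕ} {S : ℕ → Set (List Bool)}
    (hS : IsLevelTest h S) (hh : Computable h) : IsComputablyGranular S := by
  obtain ⟨g, hg, hmono, hle⟩ := exists_strictMono_ge hh
  exact ⟨g, hg, hmono, fun i σ hσ => (hS.length_eq i σ hσ).trans_le (hle i)⟩

/-- A level test is a computably granular test, so covering `X` by it suffices. -/
theorem IsLevelTest.exists_granular {h : ℕ → ℕ} {S : ℕ → Set (List Bool)} {X : BinSeq}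
    (hS : IsLevelTest h S) (hh : Computable h) (hX : ∀ i, initSeg X (h i) ∈ S i) :
    ∃ V : ℕ → Set (List Bool), IsMartinLofTest V ∧ IsComputablyGranular V ∧
      X ∈ ⋂ i, openSet (V i) :=
  ⟨S, hS.isMartinLofTest, hS.isComputablyGranular hh, Set.mem_iInter.2 fun i => ⟨_, hX i⟩⟩

/-- In a `g`-granular test the strings of the `i`-th component can be extended to length `g i`
without changing the open set. -/
theorem exists_levelTest {V : ℕ → Set (List Bool)} (hV : IsMartinLofTest V)
    (hgran : IsComputablyGranular V) :
    ∃ (h : ℕ → ℕ) (S : ℕ → Set (List Bool)), Computable h ∧ StrictMono h ∧ IsLevelTest h S ∧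
      ∀ X ∈ ⋂ i, openSet (V i), ∀ i, initSeg X (h i) ∈ S i := by
  obtain ⟨g, hg, hmono, hle⟩ := hgran
  let S : ℕ → Set (List Bool) := fun i => {σ | σ.length = g i ∧ ∃ n, σ.take n ∈ V i}
  have hopen : ∀ i, openSet (S i) ⊆ openSet (V i) := by
    rintro i X ⟨n, -, m, hm⟩
    refine ⟨min m n, ?_⟩
    rcases le_total m n with h | h
    · rwa [min_eq_left h, ← initSeg_take X h]
    · rw [min_eq_right h]
      have h' : (initSeg X n).length ≤ m := (length_initSeg X n).trans_le h
      rwa [List.take_of_length_le h'] at hm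
  refine ⟨g, S, hg, hmono, ⟨?_, fun i σ hσ => hσ.1, fun i => ?_⟩, fun X hX i => ?_⟩
  · have h1 : REPred fun p : ℕ × List Bool => p.2.length = g p.1 :=
      (Primrec.eq.computablePred_comp (Computable.list_length.comp Computable.snd)
        (hg.comp Computable.fst)).to_re
    have h2 : REPred fun q : (ℕ × List Bool) × ℕ => q.1.2.take q.2 ∈ V q.1.1 :=
      hV.ce.comp (f := fun q : (ℕ × List Bool) × ℕ => (q.1.1, q.1.2.take q.2))
        (((Primrec.fst.comp Primrec.fst).pair (Primrec.list_take.comp Primrec.snd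
          (Primrec.snd.comp Primrec.fst))).to_comp)
    exact h1.and h2.exists
  · rw [← card_mul_inv_pow_lt_iff, ← lebesgue_openSet (V := S i) fun σ hσ => hσ.1]
    exact (measure_mono (hopen i)).trans_lt (hV.measure_lt i)
  · obtain ⟨n, hn⟩ := Set.mem_iInter.1 hX i
    have hng : n ≤ g i := by simpa [length_initSeg] using hle i _ hn
    exact ⟨length_initSeg _ _, n, by rwa [initSeg_take X hng]⟩

/-! ### Martingales -/

/-- Markov's inequality for a supermartingale at a fixed level above the string `ρ`. -/
theorem IsStringSupermartingale.ncard_mul_le {M : List Bool → ℝ} (hM : IsStringSupermartingale M)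
    {t : ℝ} (ht : 0 ≤ t) (n : ℕ) (ρ : List Bool) :
    ({σ : List Bool | σ.length = n ∧ t < M (ρ ++ σ)}.ncard : ℝ) * t ≤ 2 ^ n * M ρ := by
  induction n generalizing ρ with
  | zero =>
    by_cases h : t < M ρ
    · have : {σ : List Bool | σ.length = 0 ∧ t < M (ρ ++ σ)} = {[]} := by
        ext σ
        simp only [Set.mem_ofPred_eq, List.length_eq_zero_iff, Set.mem_singleton_iff]
        exact ⟨fun hσ => hσ.1, fun hσ => ⟨hσ, by simpa [hσ] using h⟩⟩
      rw [this]
      simpa using h.le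
    · have : {σ : List Bool | σ.length = 0 ∧ t < M (ρ ++ σ)} = ∅ := by
        refine Set.eq_empty_of_forall_notMem ?_
        rintro σ ⟨h0, hσ⟩
        rw [List.length_eq_zero_iff.1 h0, List.append_nil] at hσ
        exact h hσ
      rw [this]
      simpa using hM.nonneg ρ
  | succ n ih =>
    set A : List Bool → Set (List Bool) := fun ρ => {σ | σ.length = n ∧ t < M (ρ ++ σ)} with hA
    have hfin : ∀ ρ, (A ρ).Finite := fun ρ => finite_of_length_eq fun σ hσ => hσ.1
    have hsub : {σ : List Bool | σ.length = n + 1 ∧ t < M (ρ ++ σ)} ⊆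
        List.cons false '' A (ρ ++ [false]) ∪ List.cons true '' A (ρ ++ [true]) := by
      rintro (_ | ⟨b, σ⟩) ⟨hl, hσ⟩
      · simp at hl
      · have : σ ∈ A (ρ ++ [b]) := ⟨by simpa using hl, by simpa [hA] using hσ⟩
        cases b
        · exact Or.inl ⟨σ, this, rfl⟩
        · exact Or.inr ⟨σ, this, rfl⟩
    have hcard : {σ : List Bool | σ.length = n + 1 ∧ t < M (ρ ++ σ)}.ncard ≤
        (A (ρ ++ [false])).ncard + (A (ρ ++ [true])).ncard :=
      ((Set.ncard_le_ncard hsub (((hfin _).image _).union ((hfin _).image _))).trans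
        (Set.ncard_union_le _ _)).trans
        (add_le_add (Set.ncard_image_le (hfin _)) (Set.ncard_image_le (hfin _)))
    have hcard' : ({σ : List Bool | σ.length = n + 1 ∧ t < M (ρ ++ σ)}.ncard : ℝ) ≤
        (A (ρ ++ [false])).ncard + (A (ρ ++ [true])).ncard := by exact_mod_cast hcard
    calc _ ≤ ((A (ρ ++ [false])).ncard + (A (ρ ++ [true])).ncard : ℝ) * t :=
          mul_le_mul_of_nonneg_right hcard' ht
      _ ≤ 2 ^ n * M (ρ ++ [false]) + 2 ^ n * M (ρ ++ [true]) := by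
          rw [add_mul]
          exact add_le_add (ih _) (ih _)
      _ = 2 ^ n * (M (ρ ++ [false]) + M (ρ ++ [true])) := by ring
      _ ≤ 2 ^ n * (2 * M ρ) := mul_le_mul_of_nonneg_left (hM.le_fair ρ) (by positivity)
      _ = 2 ^ (n + 1) * M ρ := by ring

/-- The strings on which a c.e. supermartingale exceeds suitable thresholds, taken at computably
chosen levels, form a level test. -/
theorem IsStringSupermartingale.exists_levelTest {M : List Bool → ℝ}
    (hM : IsStringSupermartingale M) (hce : IsCE M) {g : ℕ → ℕ} (hg : Computable g) {X : BinSeq}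
    (hX : ∀ i : ℕ, (i : ℝ) ≤ M (initSeg X (g i))) :
    ∃ h S, Computable h ∧ IsLevelTest h S ∧ ∀ i, initSeg X (h i) ∈ S i := by
  obtain ⟨c, hc⟩ := exists_nat_gt (M [])
  -- by Markov's inequality, a value above `c * 2 ^ (i + 1)` has probability below `2 ^ (-i)`
  let T : ℕ → ℕ := fun i => c * 2 ^ (i + 1)
  have hT : Computable T := Primrec.to_comp (Primrec.nat_mul.comp (Primrec.const c)
    (primrec_pow.comp (Primrec.const 2) Primrec.succ))
  have hcpos : (0 : ℝ) < c := (hM.nonneg _).trans_lt hc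
  let h : ℕ → ℕ := fun i => g (T i + 1)
  have hh : Computable h := hg.comp (Computable.succ.comp hT)
  refine ⟨h, fun i => {σ | σ.length = h i ∧ (T i : ℝ) < M σ}, hh,
    ⟨?_, fun i σ hσ => hσ.1, fun i => ?_⟩, fun i => ⟨length_initSeg _ _, ?_⟩⟩
  · refine (Primrec.eq.computablePred_comp (Computable.list_length.comp Computable.snd)
      (hh.comp Computable.fst)).to_re.and ?_
    refine (REPred.comp hce (f := fun p : ℕ × List Bool => (p.2, (T p.1, 0)))
      (Computable.snd.pair ((hT.comp Computable.fst).pair (Computable.const 0)))).of_eq fun p => ?_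
    simp
  · have hle := hM.ncard_mul_le (Nat.cast_nonneg (T i)) (h i) []
    simp only [List.nil_append] at hle
    set k := {σ : List Bool | σ.length = h i ∧ (T i : ℝ) < M σ}.ncard
    have h1 : (k : ℝ) * T i ≤ 2 ^ h i * c :=
      hle.trans (mul_le_mul_of_nonneg_left hc.le (by positivity))
    have h2 : ((k * 2 ^ i * 2 : ℕ) : ℝ) ≤ ((2 ^ h i : ℕ) : ℝ) := by
      refine le_of_mul_le_mul_right ?_ hcpos
      push_cast [T] at h1 ⊢
      calc _ = (k : ℝ) * (c * 2 ^ (i + 1)) := by ring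
        _ ≤ _ := h1
    have h3 : k * 2 ^ i * 2 ≤ 2 ^ h i := by exact_mod_cast h2
    have : 0 < 2 ^ h i := by positivity
    omega
  · have := hX (T i + 1)
    push_cast at this
    change (T i : ℝ) < M (initSeg X (g (T i + 1)))
    linarith

/-- The conditional measure of the cylinder of `τ` given the cylinder of `σ`. -/
noncomputable def condWeight (τ σ : List Bool) : ℝ :=
  if τ <+: σ then 1 else if σ <+: τ then 2 ^ σ.length / 2 ^ τ.length else 0

theorem condWeight_nonneg (τ σ : List Bool) : 0 ≤ condWeight τ σ := by
  unfold condWeight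
  split_ifs <;> positivity

theorem condWeight_of_prefix {τ σ : List Bool} (h : σ <+: τ) :
    condWeight τ σ = 2 ^ σ.length / 2 ^ τ.length := by
  unfold condWeight
  split_ifs with h'
  · rw [h'.eq_of_length_le h.length_le, div_self (by positivity)]
  · rfl

theorem condWeight_fair (τ σ : List Bool) :
    condWeight τ (σ ++ [false]) + condWeight τ (σ ++ [true]) = 2 * condWeight τ σ := by
  by_cases h1 : τ <+: σ
  · have : ∀ b, condWeight τ (σ ++ [b]) = 1 := fun b =>
      if_pos (h1.trans (List.prefix_append _ _))
    rw [this, this, condWeight, if_pos h1]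
    norm_num
  · by_cases h2 : σ <+: τ
    · obtain ⟨_ | ⟨b, ρ⟩, rfl⟩ := h2
      · simp at h1
      · have hyes : condWeight (σ ++ b :: ρ) (σ ++ [b]) =
            2 ^ (σ.length + 1) / 2 ^ (σ ++ b :: ρ).length := by
          rw [condWeight_of_prefix (by simp)]
          simp
        have hno : condWeight (σ ++ b :: ρ) (σ ++ [!b]) = 0 := by
          rw [condWeight, if_neg, if_neg]
          · simp
          · intro h
            simp only [List.prefix_append_right_inj, List.cons_prefix_cons] at h
            cases b <;> simp at h
        have hsum : condWeight (σ ++ b :: ρ) (σ ++ [b]) + condWeight (σ ++ b :: ρ) (σ ++ [!b]) =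
            2 * condWeight (σ ++ b :: ρ) σ := by
          rw [hyes, hno, condWeight_of_prefix (List.prefix_append _ _)]
          ring
        cases b
        · exact hsum
        · rw [add_comm]
          exact hsum
    · have : ∀ b, condWeight τ (σ ++ [b]) = 0 := by
        intro b
        rw [condWeight, if_neg, if_neg]
        · exact fun h => h2 ((List.prefix_append _ _).trans h)
        · intro h
          rcases List.prefix_concat_iff.1 h with h | h
          · exact h2 (h ▸ List.prefix_append _ _)
          · exact h1 h
      rw [this, this, condWeight, if_neg h1, if_neg h2]
      norm_num

theorem condWeight_le (τ σ : List Bool) : condWeight τ σ ≤ 2 ^ σ.length / 2 ^ τ.length := by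
  unfold condWeight
  split_ifs with h
  · rw [le_div_iff₀ (by positivity), one_mul]
    exact pow_le_pow_right₀ (by norm_num) h.length_le
  · exact le_rfl
  · positivity

/-- The number `2 ^ N * condWeight τ σ` as an integer; strings `τ` longer than `N`, for which it
need not be one, are ignored. -/
def scaledWeight (N : ℕ) (τ σ : List Bool) : ℕ :=
  if τ.length ≤ N then
    if τ = σ.take τ.length then 2 ^ N
    else if σ = τ.take σ.length then 2 ^ (σ.length + (N - τ.length)) else 0
  else 0

theorem scaledWeight_eq {N : ℕ} {τ : List Bool} (h : τ.length ≤ N) (σ : List Bool) :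
    (scaledWeight N τ σ : ℝ) = 2 ^ N * condWeight τ σ := by
  unfold scaledWeight condWeight
  rw [if_pos h]
  simp only [← List.prefix_iff_eq_take]
  split_ifs
  · simp
  · obtain ⟨k, rfl⟩ := Nat.exists_eq_add_of_le h
    rw [Nat.add_sub_cancel_left]
    push_cast
    rw [pow_add, pow_add]
    field_simp
  · simp

theorem scaledWeight_le (N : ℕ) (τ σ : List Bool) :
    (scaledWeight N τ σ : ℝ) ≤ 2 ^ N * condWeight τ σ := by
  by_cases h : τ.length ≤ N
  · exact (scaledWeight_eq h σ).le
  · rw [scaledWeight, if_neg h, Nat.cast_zero]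
    exact mul_nonneg (by positivity) (condWeight_nonneg τ σ)

theorem primrec_scaledWeight :
    Primrec fun q : ℕ × List Bool × List Bool => scaledWeight q.1 q.2.1 q.2.2 := by
  have hτ : Primrec fun q : ℕ × List Bool × List Bool => q.2.1 := Primrec.fst.comp Primrec.snd
  have hσ : Primrec fun q : ℕ × List Bool × List Bool => q.2.2 := Primrec.snd.comp Primrec.snd
  have lτ := Primrec.list_length.comp hτ
  have lσ := Primrec.list_length.comp hσ
  refine Primrec.ite (Primrec.nat_le.comp lτ Primrec.fst) ?_ (Primrec.const 0)
  refine Primrec.ite (Primrec.eq.comp hτ (Primrec.list_take.comp lτ hσ))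
    (primrec_pow.comp (Primrec.const 2) Primrec.fst) ?_
  exact Primrec.ite (Primrec.eq.comp hσ (Primrec.list_take.comp lσ hτ))
    (primrec_pow.comp (Primrec.const 2) (Primrec.nat_add.comp lσ
      (Primrec.nat_sub.comp Primrec.fst lτ))) (Primrec.const 0)

/-- The sum of the martingales `condWeight τ` over all strings `τ` of a test, counted once for each
component in which they occur; for a level test the series converges
(`IsLevelTest.summable_condWeight`). -/
noncomputable def testMartingale (S : ℕ → Set (List Bool)) (σ : List Bool) : ℝ :=
  ∑' p : {p : ℕ × List Bool // p.2 ∈ S p.1}, condWeight p.1.2 σ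

/-- The total weight of a level test is at most `∑ i, 2 ^ (-i) = 2`. -/
theorem IsLevelTest.sum_le {h : ℕ → ℕ} {S : ℕ → Set (List Bool)} (hS : IsLevelTest h S)
    (u : Finset (ℕ × List Bool)) (hu : ∀ p ∈ u, p.2 ∈ S p.1) :
    ∑ p ∈ u, (1 : ℝ) / 2 ^ p.2.length ≤ 2 := by
  classical
  calc ∑ p ∈ u, (1 : ℝ) / 2 ^ p.2.length
      = ∑ i ∈ u.image Prod.fst, ∑ p ∈ u with p.1 = i, (1 : ℝ) / 2 ^ p.2.length :=
        (Finset.sum_fiberwise_of_maps_to (fun p hp => Finset.mem_image_of_mem _ hp) _).symm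
    _ ≤ ∑ i ∈ u.image Prod.fst, (1 / 2 : ℝ) ^ i := by
        refine Finset.sum_le_sum fun i _ => ?_
        have hlen : ∀ p ∈ u.filter (fun p => p.1 = i), (1 : ℝ) / 2 ^ p.2.length = 1 / 2 ^ h i := by
          intro p hp
          obtain ⟨hpu, rfl⟩ := Finset.mem_filter.1 hp
          rw [hS.length_eq _ _ (hu p hpu)]
        rw [Finset.sum_congr rfl hlen, Finset.sum_const, nsmul_eq_mul]
        have hcard : (u.filter (fun p => p.1 = i)).card ≤ (S i).ncard := by
          rw [← Set.ncard_coe_finset]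
          refine Set.ncard_le_ncard_of_injOn Prod.snd ?_ ?_ (finite_of_length_eq (hS.length_eq i))
          · intro p hp
            obtain ⟨hpu, rfl⟩ := Finset.mem_filter.1 (Finset.mem_coe.1 hp)
            exact hu p hpu
          · intro p hp q hq hpq
            have hp := (Finset.mem_filter.1 (Finset.mem_coe.1 hp)).2
            have hq := (Finset.mem_filter.1 (Finset.mem_coe.1 hq)).2
            exact Prod.ext (hp.trans hq.symm) hpq
        have hlt : (((u.filter (fun p => p.1 = i)).card * 2 ^ i : ℕ) : ℝ) ≤ ((2 ^ h i : ℕ) : ℝ) :=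
          Nat.cast_le.2 ((Nat.mul_le_mul_right _ hcard).trans (hS.card_lt i).le)
        push_cast at hlt
        rw [one_div_pow, mul_one_div, div_le_div_iff₀ (by positivity) (by positivity), one_mul]
        exact hlt
    _ ≤ ∑' i, (1 / 2 : ℝ) ^ i :=
        summable_geometric_two.sum_le_tsum _ fun i _ => by positivity
    _ = 2 := tsum_geometric_two

theorem IsLevelTest.summable_condWeight {h : ℕ → ℕ} {S : ℕ → Set (List Bool)}
    (hS : IsLevelTest h S) (σ : List Bool) :
    Summable fun p : {p : ℕ × List Bool // p.2 ∈ S p.1} => condWeight p.1.2 σ := by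
  refine summable_of_sum_le (c := 2 ^ σ.length * 2) (fun p => condWeight_nonneg _ _) fun u => ?_
  have h1 := hS.sum_le (u.map (Function.Embedding.subtype _)) (by
    intro p hp
    obtain ⟨q, -, rfl⟩ := Finset.mem_map.1 hp
    exact q.2)
  rw [Finset.sum_map] at h1
  refine le_trans ?_ (mul_le_mul_of_nonneg_left h1 (by positivity))
  rw [Finset.mul_sum]
  refine Finset.sum_le_sum fun p _ => (condWeight_le _ _).trans_eq ?_
  rw [mul_one_div]
  rfl

theorem IsLevelTest.isStringMartingale {h : ℕ → ℕ} {S : ℕ → Set (List Bool)}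
    (hS : IsLevelTest h S) : IsStringMartingale (testMartingale S) where
  nonneg σ := tsum_nonneg fun p => condWeight_nonneg _ _
  fair σ := by
    unfold testMartingale
    rw [← (hS.summable_condWeight _).tsum_add (hS.summable_condWeight _), ← tsum_mul_left]
    exact tsum_congr fun p => condWeight_fair _ _

theorem IsLevelTest.sum_le_testMartingale {h : ℕ → ℕ} {S : ℕ → Set (List Bool)}
    (hS : IsLevelTest h S) (σ : List Bool) (u : Finset (ℕ × List Bool))
    (hu : ∀ p ∈ u, p.2 ∈ S p.1) :
    ∑ p ∈ u, condWeight p.2 σ ≤ testMartingale S σ := by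
  classical
  rw [← Finset.sum_subtype_of_mem (fun p : ℕ × List Bool => condWeight p.2 σ) hu]
  exact (hS.summable_condWeight σ).sum_le_tsum _ fun p _ => condWeight_nonneg _ _

/-- The martingale of a level test is approximated from below by the sums over the finite stages
of an enumeration of the test. -/
theorem IsLevelTest.isCE {h : ℕ → ℕ} {S : ℕ → Set (List Bool)} (hS : IsLevelTest h S) :
    IsCE (testMartingale S) := by
  classical
  obtain ⟨L, hL, hnd, hpre, hmem⟩ := REPred.exists_enumeration
    (S := fun _ : Unit => {p : ℕ × List Bool | p.2 ∈ S p.1})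
    (hS.ce.comp (f := fun q : Unit × (ℕ × List Bool) => q.2) Computable.snd)
  have hLS : ∀ s, ∀ p ∈ (L () s).toFinset, p.2 ∈ S p.1 := fun s p hp =>
    (hmem () p).2 ⟨s, List.mem_toFinset.1 hp⟩
  let A : List Bool → ℕ → ℕ → ℕ := fun σ s N =>
    ((L () s).map fun p => scaledWeight N p.2 σ).foldr (fun x y => x + y) 0
  have hA : ∀ σ s N, (A σ s N : ℝ) = ∑ p ∈ (L () s).toFinset, (scaledWeight N p.2 σ : ℝ) := by
    intro σ s N
    rw [← Nat.cast_sum, List.sum_toFinset _ (hnd () s)]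
    rfl
  have hAprim : Primrec fun q : List Bool × ℕ × ℕ => A q.1 q.2.1 q.2.2 := by
    refine Primrec.list_foldr (h := fun (_ : List Bool × ℕ × ℕ) (z : ℕ × ℕ) => z.1 + z.2)
      (Primrec.list_map (hL.comp (Primrec.const ()) (Primrec.fst.comp Primrec.snd)) ?_)
      (Primrec.const 0)
      (Primrec.nat_add.comp (Primrec.fst.comp Primrec.snd) (Primrec.snd.comp Primrec.snd))
    exact primrec_scaledWeight.comp ((Primrec.snd.comp (Primrec.snd.comp Primrec.fst)).pair
      ((Primrec.snd.comp Primrec.snd).pair (Primrec.fst.comp Primrec.fst)))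
  have hre : REPred fun q : (List Bool × ℕ × ℕ) × ℕ × ℕ =>
      q.1.2.1 * 2 ^ q.2.2 < A q.1.1 q.2.1 q.2.2 * (q.1.2.2 + 1) := by
    refine (Primrec.nat_lt.computablePred_comp (Primrec.to_comp ?_) (Primrec.to_comp ?_)).to_re
    · exact Primrec.nat_mul.comp (Primrec.fst.comp (Primrec.snd.comp Primrec.fst))
        (primrec_pow.comp (Primrec.const 2) (Primrec.snd.comp Primrec.snd))
    · exact Primrec.nat_mul.comp (hAprim.comp ((Primrec.fst.comp Primrec.fst).pair Primrec.snd))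
        (Primrec.succ.comp (Primrec.snd.comp (Primrec.snd.comp Primrec.fst)))
  refine hre.exists.of_eq ?_
  rintro ⟨σ, a, b⟩
  have hcast : ∀ s N, a * 2 ^ N < A σ s N * (b + 1) ↔
      (a : ℝ) / ((b : ℝ) + 1) * 2 ^ N < A σ s N := by
    intro s N
    rw [div_mul_eq_mul_div, div_lt_iff₀ (by positivity)]
    exact_mod_cast Iff.rfl
  simp only [Prod.exists, hcast]
  constructor
  · rintro ⟨s, N, hlt⟩
    refine lt_of_mul_lt_mul_right (a := (2 : ℝ) ^ N) (hlt.trans_le ?_) (by positivity)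
    rw [hA, mul_comm]
    refine (Finset.sum_le_sum fun p _ => scaledWeight_le N p.2 σ).trans ?_
    rw [← Finset.mul_sum]
    exact mul_le_mul_of_nonneg_left (hS.sum_le_testMartingale σ _ (hLS s)) (by positivity)
  · intro hlt
    obtain ⟨u, hu⟩ := ((hS.summable_condWeight σ).hasSum.eventually (lt_mem_nhds hlt)).exists
    -- a stage at which all members of the finite set `u` are listed
    have hstage : ∃ s, ∀ p ∈ u, p.1 ∈ L () s := by
      choose f hf using fun p : {p : ℕ × List Bool // p.2 ∈ S p.1} => (hmem () p.1).1 p.2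
      exact ⟨u.sup f, fun p hp => (hpre () _ _ (Finset.le_sup hp)).subset (hf p)⟩
    obtain ⟨s, hs⟩ := hstage
    let N := (L () s).toFinset.sup fun p => p.2.length
    refine ⟨s, N, ?_⟩
    have hN : ∀ p ∈ (L () s).toFinset, (scaledWeight N p.2 σ : ℝ) = 2 ^ N * condWeight p.2 σ :=
      fun p hp => scaledWeight_eq (Finset.le_sup (f := fun p : ℕ × List Bool => p.2.length) hp) σ
    rw [hA, Finset.sum_congr rfl hN, ← Finset.mul_sum, mul_comm]
    refine mul_lt_mul_of_pos_left (hu.trans_le ?_) (by positivity)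
    have hsub : u.map (Function.Embedding.subtype _) ⊆ (L () s).toFinset := by
      intro p hp
      obtain ⟨q, hq, rfl⟩ := Finset.mem_map.1 hp
      exact List.mem_toFinset.2 (hs q hq)
    refine le_trans (le_of_eq ?_) (Finset.sum_le_sum_of_subset_of_nonneg hsub
      fun p _ _ => condWeight_nonneg p.2 σ)
    rw [Finset.sum_map]
    rfl

/-- Along a covered real, at level `h i` the martingale has already collected the full capital of the
components below `i`. -/
theorem IsLevelTest.le_testMartingale {h : ℕ → ℕ} {S : ℕ → Set (List Bool)}
    (hS : IsLevelTest h S) (hmono : StrictMono h) {X : BinSeq}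
    (hX : ∀ i, initSeg X (h i) ∈ S i) (i : ℕ) :
    (i : ℝ) ≤ testMartingale S (initSeg X (h i)) := by
  classical
  have hinj : Function.Injective fun j => (j, initSeg X (h j)) := fun j k hjk =>
    congrArg Prod.fst hjk
  have := hS.sum_le_testMartingale (initSeg X (h i)) ((Finset.range i).map ⟨_, hinj⟩) (by
    intro p hp
    obtain ⟨j, -, rfl⟩ := Finset.mem_map.1 hp
    exact hX j)
  rw [Finset.sum_map] at this
  refine le_trans (le_of_eq ?_) this
  have hone : ∀ j ∈ Finset.range i, condWeight (initSeg X (h j)) (initSeg X (h i)) = 1 :=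
    fun j hj => if_pos (initSeg_prefix X (hmono.monotone (Finset.mem_range.1 hj).le))
  refine Eq.trans ?_ (Finset.sum_congr rfl hone).symm
  simp

/-! ### Machines and complexity -/

theorem complexity_le_length {U : List Bool →. List Bool} {σ τ : List Bool} (h : σ ∈ U τ) :
    complexity U σ ≤ τ.length :=
  iInf₂_le τ h

theorem exists_program_of_complexity_le {U : List Bool →. List Bool} {σ : List Bool} {n : ℕ}
    (h : complexity U σ ≤ n) : ∃ τ, σ ∈ U τ ∧ τ.length ≤ n := by
  by_contra! hn
  have : ((n + 1 : ℕ) : ℕ∞) ≤ complexity U σ :=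
    le_iInf₂ fun τ hτ => by exact_mod_cast hn τ hτ
  have h' : ((n + 1 : ℕ) : ℕ∞) ≤ n := this.trans h
  have : n + 1 ≤ n := by exact_mod_cast h'
  omega

/-- The number with binary digits `τ`, least significant digit first. -/
def binVal (τ : List Bool) : ℕ := τ.foldr (fun b n => b.toNat + 2 * n) 0

theorem primrec_binVal : Primrec binVal := by
  refine Primrec.list_foldr (h := fun (_ : List Bool) (p : Bool × ℕ) => p.1.toNat + 2 * p.2)
    Primrec.id (Primrec.const 0) ?_
  exact Primrec.nat_add.comp
    ((Primrec.dom_bool Bool.toNat).comp (Primrec.fst.comp Primrec.snd))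
    (Primrec.nat_mul.comp (Primrec.const 2) (Primrec.snd.comp Primrec.snd))

theorem exists_binVal_eq (m : ℕ) : ∀ k < 2 ^ m, ∃ τ : List Bool, τ.length = m ∧ binVal τ = k := by
  induction m with
  | zero => exact fun k hk => ⟨[], rfl, by simp at hk; simp [binVal, hk]⟩
  | succ m ih =>
    intro k hk
    obtain ⟨τ, hτ, hv⟩ := ih (k / 2) (by rw [pow_succ] at hk; omega)
    refine ⟨decide (k % 2 = 1) :: τ, by simp [hτ], ?_⟩
    have : binVal (decide (k % 2 = 1) :: τ) = (decide (k % 2 = 1)).toNat + 2 * binVal τ := rfl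
    rw [this, hv]
    rcases Nat.mod_two_eq_zero_or_one k with h | h <;> simp [h] <;> omega

/-- The machine that on a program `0ⁱ1τ` with `|τ| = m i` outputs the entry of number `binVal τ`
in the increasing union of the lists `L i s`, and that diverges on all other inputs. -/
def blockMachine (m : ℕ → ℕ) (L : ℕ → ℕ → List (List Bool)) : List Bool →. List Bool := fun ρ =>
  Nat.rfindOpt fun s =>
    if ρ.length = ρ.idxOf true + (m (ρ.idxOf true) + 1) then
      (L (ρ.idxOf true) s)[binVal (ρ.drop (ρ.idxOf true + 1))]?
    else none

theorem partrec_blockMachine {m : ℕ → ℕ} (hm : Computable m) {L : ℕ → ℕ → List (List Bool)}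
    (hL : Primrec₂ L) : Partrec (blockMachine m L) := by
  refine Partrec.rfindOpt ?_
  have hi : Primrec fun p : List Bool × ℕ => p.1.idxOf true :=
    Primrec.list_idxOf.comp (Primrec.const true) Primrec.fst
  have hc : ComputablePred fun p : List Bool × ℕ =>
      p.1.length = p.1.idxOf true + (m (p.1.idxOf true) + 1) :=
    Primrec.eq.computablePred_comp (Computable.list_length.comp Computable.fst)
      (Primrec.nat_add.to_comp.comp hi.to_comp (Computable.succ.comp (hm.comp hi.to_comp)))
  have hv : Primrec fun p : List Bool × ℕ =>
      (L (p.1.idxOf true) p.2)[binVal (p.1.drop (p.1.idxOf true + 1))]? :=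
    Primrec.list_getElem?.comp (hL.comp hi Primrec.snd)
      (primrec_binVal.comp (Primrec.list_drop.comp (Primrec.succ.comp hi) Primrec.fst))
  refine (Computable.cond hc.decide hv.to_comp (Computable.const none)).of_eq fun p => ?_
  rw [Bool.cond_decide]

/-- The domain is prefix-free: a program determines its own length after the first `1`. -/
theorem blockMachine_prefixFree (m : ℕ → ℕ) (L : ℕ → ℕ → List (List Bool)) (σ τ : List Bool)
    (hσ : (blockMachine m L σ).Dom) (hτ : (blockMachine m L τ).Dom) (h : σ <+: τ) : σ = τ := by
  have key : ∀ ρ, (blockMachine m L ρ).Dom →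
      ρ.length = ρ.idxOf true + (m (ρ.idxOf true) + 1) := by
    intro ρ hρ
    obtain ⟨s, a, ha⟩ := Nat.rfindOpt_dom.1 hρ
    by_contra hne
    simp [hne] at ha
  have h1 := key σ hσ
  have h2 := key τ hτ
  obtain ⟨t, rfl⟩ := h
  have hmem : true ∈ σ := List.idxOf_lt_length_iff.1 (by omega)
  rw [List.idxOf_append_of_mem hmem, ← h1] at h2
  exact (List.prefix_append σ t).eq_of_length h2.symm

/-- If the `i`-th section of an r.e. relation has at most `2 ^ m i` elements, these have prefix-free
descriptions consisting of `i` in unary and an index of `m i` bits. -/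
theorem exists_prefixFree_machine {S : ℕ → Set (List Bool)} {m : ℕ → ℕ} (hm : Computable m)
    (hS : REPred fun p : ℕ × List Bool => p.2 ∈ S p.1) (hfin : ∀ i, (S i).Finite)
    (hcard : ∀ i, (S i).ncard ≤ 2 ^ m i) :
    ∃ N : List Bool →. List Bool, IsPrefixFreeMachine N ∧
      ∀ i, ∀ σ ∈ S i, complexity N σ ≤ (i + (m i + 1) : ℕ) := by
  obtain ⟨L, hL, hnd, hpre, hmem⟩ := hS.exists_enumeration
  refine ⟨blockMachine m L, ⟨partrec_blockMachine hm hL, blockMachine_prefixFree m L⟩, ?_⟩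
  intro i σ hσ
  obtain ⟨s, hs⟩ := (hmem i σ).1 hσ
  obtain ⟨k, hk, hkσ⟩ := List.mem_iff_getElem.1 hs
  have hlen : (L i s).length ≤ 2 ^ m i := by
    rw [← List.toFinset_card_of_nodup (hnd i s), ← Set.ncard_coe_finset]
    refine (Set.ncard_le_ncard (fun x hx => ?_) (hfin i)).trans (hcard i)
    exact (hmem i x).2 ⟨s, by simpa using hx⟩
  obtain ⟨τ, hτ, hv⟩ := exists_binVal_eq (m i) k (hk.trans_le hlen)
  have hidx : (List.replicate i false ++ true :: τ).idxOf true = i := by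
    rw [List.idxOf_append_of_notMem (by simp)]
    simp
  have hdrop : (List.replicate i false ++ true :: τ).drop (i + 1) = τ := by
    rw [List.drop_append]
    simp
  have hrun : σ ∈ blockMachine m L (List.replicate i false ++ true :: τ) := by
    refine (Nat.rfindOpt_mono ?_).2 ⟨s, ?_⟩
    · intro a s t hst ha
      split_ifs at ha ⊢ with hc
      · obtain ⟨l, hl⟩ := hpre (List.idxOf true (List.replicate i false ++ true :: τ)) s t hst
        rw [← hl]
        exact List.getElem?_append_left (List.getElem?_eq_some_iff.1 ha).1 |>.trans ha
      · exact ha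
    · simp [hidx, hdrop, hτ, hv, hkσ, hk]
  simpa [hτ] using complexity_le_length hrun

/-- Describing the members of the component `2 * i` of a level test by `i` in unary and an index of
`h (2 * i) - 2 * i` bits saves `i - 1` bits. -/
theorem IsLevelTest.exists_complexity_le {h : ℕ → ℕ} {S : ℕ → Set (List Bool)}
    (hS : IsLevelTest h S) {U : List Bool →. List Bool} (hU : IsUniversalPrefixFree U)
    (hh : Computable h) (hmono : StrictMono h) {X : BinSeq} (hX : ∀ i, initSeg X (h i) ∈ S i) :
    ∃ g : ℕ → ℕ, Computable g ∧
      ∀ i : ℕ, complexity U (initSeg X (g i)) + (i : ℕ∞) ≤ (g i : ℕ∞) := by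
  have hdouble : Computable fun i : ℕ => 2 * i := Primrec.nat_double.to_comp
  have hm : Computable fun i : ℕ => h (2 * i) - 2 * i :=
    Primrec.nat_sub.to_comp.comp (hh.comp hdouble) hdouble
  have hle : ∀ i, i ≤ h i := hmono.id_le
  obtain ⟨N, hN, hNS⟩ := exists_prefixFree_machine (S := fun i => S (2 * i)) hm
    (hS.ce.comp (f := fun p : ℕ × List Bool => (2 * p.1, p.2))
      ((hdouble.comp Computable.fst).pair Computable.snd))
    (fun i => finite_of_length_eq (hS.length_eq _)) (fun i => by
      refine Nat.le_of_mul_le_mul_right ?_ (pow_pos two_pos (2 * i))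
      rw [← pow_add, Nat.sub_add_cancel (hle _)]
      exact (hS.card_lt _).le)
  obtain ⟨c, hc⟩ := hU.optimal N hN
  -- the shift by `c + 1` pays for the delimiter and for the optimality constant
  have hshift : Computable fun i : ℕ => 2 * (i + (c + 1)) :=
    hdouble.comp (Primrec.nat_add.comp Primrec.id (Primrec.const (c + 1))).to_comp
  refine ⟨fun i => h (2 * (i + (c + 1))), hh.comp hshift, fun i => ?_⟩
  have h1 := (hc _).trans (add_le_add_left (hNS (i + (c + 1)) _ (hX _)) (c : ℕ∞))
  refine (add_le_add_left h1 (i : ℕ∞)).trans ?_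
  have h2 := hle (2 * (i + (c + 1)))
  norm_cast
  dsimp only
  omega

theorem ncard_length_eq (n : ℕ) : {σ : List Bool | σ.length = n}.ncard = 2 ^ n := by
  rw [← Nat.card_coe_set_eq]
  have := card_vector (α := Bool) n
  rw [Fintype.card_bool] at this
  rw [← this, ← Nat.card_eq_fintype_card]
  rfl

theorem ncard_length_le (m : ℕ) : {τ : List Bool | τ.length ≤ m}.ncard < 2 ^ (m + 1) := by
  induction m with
  | zero =>
    have : {τ : List Bool | τ.length ≤ 0} = {τ : List Bool | τ.length = 0} := by
      ext; simp
    rw [this, ncard_length_eq]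
    norm_num
  | succ m ih =>
    have : {τ : List Bool | τ.length ≤ m + 1} =
        {τ : List Bool | τ.length ≤ m} ∪ {τ : List Bool | τ.length = m + 1} := by
      ext; simp; omega
    rw [this]
    have h := Set.ncard_union_le {τ : List Bool | τ.length ≤ m} {τ : List Bool | τ.length = m + 1}
    rw [ncard_length_eq] at h
    rw [pow_succ 2 (m + 1)]
    omega

/-- A partial function has fewer than `2 ^ (m + 1)` values on the strings of length at most `m`. -/
theorem finite_and_ncard_values_lt (W : List Bool →. List Bool) (m : ℕ) :
    {σ | ∃ τ : List Bool, τ.length ≤ m ∧ σ ∈ W τ}.Finite ∧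
      {σ | ∃ τ : List Bool, τ.length ≤ m ∧ σ ∈ W τ}.ncard < 2 ^ (m + 1) := by
  classical
  let f : List Bool → List Bool := fun τ => if h : (W τ).Dom then (W τ).get h else []
  have hsub : {σ | ∃ τ : List Bool, τ.length ≤ m ∧ σ ∈ W τ} ⊆ f '' {τ | τ.length ≤ m} := by
    rintro σ ⟨τ, hτ, hd, hσ⟩
    exact ⟨τ, hτ, by simp [f, hd, hσ]⟩
  have hfin := (List.finite_length_le Bool m).image f
  exact ⟨hfin.subset hsub, ((Set.ncard_le_ncard hsub hfin).trans
    (Set.ncard_image_le (List.finite_length_le Bool m))).trans_lt (ncard_length_le m)⟩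

/-- Strings of length `n` with a program of length at most `n - (i + 1)` are fewer than
`2 ^ (n - i)`; at computably chosen lengths they form a level test. -/
theorem exists_levelTest_of_complexity {W : List Bool →. List Bool} (hW : Partrec W) {g : ℕ → ℕ}
    (hg : Computable g) :
    ∃ S, IsLevelTest (fun i => g (i + 1)) S ∧ ∀ i σ, σ.length = g (i + 1) →
      complexity W σ + ((i + 1 : ℕ) : ℕ∞) ≤ g (i + 1) → σ ∈ S i := by
  refine ⟨fun i => {σ | σ.length = g (i + 1) ∧
    ∃ τ : List Bool, τ.length + (i + 1) ≤ g (i + 1) ∧ σ ∈ W τ}, ⟨?_, fun i σ hσ => hσ.1, ?_⟩, ?_⟩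
  · have hgi : Computable fun p : ℕ × List Bool => g (p.1 + 1) :=
      hg.comp (Computable.succ.comp Computable.fst)
    refine (Primrec.eq.computablePred_comp (Computable.list_length.comp Computable.snd)
      hgi).to_re.and ?_
    refine REPred.exists
      (p := fun q : (ℕ × List Bool) × List Bool =>
        q.2.length + (q.1.1 + 1) ≤ g (q.1.1 + 1) ∧ q.1.2 ∈ W q.2) (REPred.and ?_ ?_)
    · exact (Primrec.nat_le.computablePred_comp (Primrec.nat_add.to_comp.comp
        (Computable.list_length.comp Computable.snd)
        (Computable.succ.comp (Computable.fst.comp Computable.fst)))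
        (hgi.comp Computable.fst)).to_re
    · exact hW.mem_re.comp (f := fun q : (ℕ × List Bool) × List Bool => (q.2, q.1.2))
        (Computable.snd.pair (Computable.snd.comp Computable.fst))
  · intro i
    rcases lt_or_ge (g (i + 1)) (i + 1) with hlt | hge
    · have hempty : {σ : List Bool | σ.length = g (i + 1) ∧
          ∃ τ : List Bool, τ.length + (i + 1) ≤ g (i + 1) ∧ σ ∈ W τ} = ∅ := by
        refine Set.eq_empty_of_forall_notMem ?_
        rintro σ ⟨-, τ, hτ, -⟩
        omega
      rw [hempty]
      simp
    · obtain ⟨m, hm⟩ := Nat.exists_eq_add_of_le hge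
      have hsub : {σ : List Bool | σ.length = g (i + 1) ∧
          ∃ τ : List Bool, τ.length + (i + 1) ≤ g (i + 1) ∧ σ ∈ W τ} ⊆
          {σ | ∃ τ : List Bool, τ.length ≤ m ∧ σ ∈ W τ} := by
        rintro σ ⟨-, τ, hτ, hσ⟩
        exact ⟨τ, by omega, hσ⟩
      have hlt := (Set.ncard_le_ncard hsub (finite_and_ncard_values_lt W m).1).trans_lt
        (finite_and_ncard_values_lt W m).2
      calc _ < 2 ^ (m + 1) * 2 ^ i := Nat.mul_lt_mul_of_pos_right hlt (by positivity)
        _ = 2 ^ g (i + 1) := by rw [hm, ← pow_add]; congr 1; omega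
  · intro i σ hlen hσ
    have hle : i + 1 ≤ g (i + 1) := by exact_mod_cast le_add_self.trans hσ
    obtain ⟨m, hm⟩ := Nat.exists_eq_add_of_le hle
    have hσ' : complexity W σ ≤ m := by
      refine (ENat.add_le_add_iff_right (ENat.natCast_ne_top (i + 1))).1 (hσ.trans ?_)
      rw [hm]
      push_cast
      exact (add_comm _ _).le
    obtain ⟨τ, hτ, hlen'⟩ := exists_program_of_complexity_le hσ'
    exact ⟨hlen, τ, by omega, hτ⟩

end GranularRandomness

/-! ### The equivalence -/

/-- The inequality `K(X↾g(i)) ≤ g(i) - i` between integers is written as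
`K(X↾g(i)) + i ≤ g(i)`, and likewise for `C`. -/
theorem mainTheorem4
    (U : List Bool →. List Bool) (hU : GranularRandomness.IsUniversalPrefixFree U)
    (W : List Bool →. List Bool) (hW : GranularRandomness.IsUniversalPlain W)
    (X : GranularRandomness.BinSeq) :
    List.TFAE [
      ∃ V : ℕ → Set (List Bool), GranularRandomness.IsMartinLofTest V ∧
        GranularRandomness.IsComputablyGranular V ∧
        X ∈ ⋂ i, GranularRandomness.openSet (V i),
      ∃ M : List Bool → ℝ, GranularRandomness.IsStringMartingale M ∧
        GranularRandomness.IsCE M ∧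
        ∃ g : ℕ → ℕ, Computable g ∧
          ∀ i : ℕ, (i : ℝ) ≤ M (GranularRandomness.initSeg X (g i)),
      ∃ M : List Bool → ℝ, GranularRandomness.IsStringSupermartingale M ∧
        GranularRandomness.IsCE M ∧
        ∃ g : ℕ → ℕ, Computable g ∧
          ∀ i : ℕ, (i : ℝ) ≤ M (GranularRandomness.initSeg X (g i)),
      ∃ g : ℕ → ℕ, Computable g ∧
        ∀ i : ℕ, GranularRandomness.complexity U (GranularRandomness.initSeg X (g i)) + (i : ℕ∞)
          ≤ (g i : ℕ∞),
      ∃ g : ℕ → ℕ, Computable g ∧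
        ∀ i : ℕ, GranularRandomness.complexity W (GranularRandomness.initSeg X (g i)) + (i : ℕ∞)
          ≤ (g i : ℕ∞)] := by
  open GranularRandomness in
  tfae_have 1 → 2 := by
    rintro ⟨V, hV, hgran, hX⟩
    obtain ⟨h, S, hh, hmono, hS, hcover⟩ := exists_levelTest hV hgran
    exact ⟨testMartingale S, hS.isStringMartingale, hS.isCE, h, hh,
      hS.le_testMartingale hmono (hcover X hX)⟩
  tfae_have 2 → 3 := by
    rintro ⟨M, hM, h⟩
    exact ⟨M, ⟨hM.nonneg, fun σ => (hM.fair σ).le⟩, h⟩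
  tfae_have 3 → 1 := by
    rintro ⟨M, hM, hce, g, hg, hX⟩
    obtain ⟨h, S, hh, hS, hcover⟩ := hM.exists_levelTest hce hg hX
    exact hS.exists_granular hh hcover
  tfae_have 1 → 4 := by
    rintro ⟨V, hV, hgran, hX⟩
    obtain ⟨h, S, hh, hmono, hS, hcover⟩ := exists_levelTest hV hgran
    exact hS.exists_complexity_le hU hh hmono (hcover X hX)
  tfae_have 4 → 5 := by
    rintro ⟨g, hg, hX⟩
    obtain ⟨c, hc⟩ := hW.optimal U hU.machine.partrec
    refine ⟨fun i => g (i + c), hg.comp (Primrec.nat_add.comp Primrec.id (Primrec.const c)).to_comp,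
      fun i => ?_⟩
    refine le_trans ?_ (hX (i + c))
    refine (add_le_add_left (hc _) _).trans_eq ?_
    push_cast
    ring
  tfae_have 5 → 1 := by
    rintro ⟨g, hg, hX⟩
    obtain ⟨S, hS, hcover⟩ := exists_levelTest_of_complexity hW.partrec hg
    exact hS.exists_granular (hg.comp Computable.succ) fun i =>
      hcover i _ (length_initSeg _ _) (hX (i + 1))
  tfae_finish
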